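/- Let $d,p\ge 1$ and let $\mathbf Y(t)=(Y_1(t),\dots,Y_d(t))$, $t\in\mathbb R^p$, be an $\mathbb R^d$-valued Gaussian process with centered components and continuous sample paths. Put $Z_i(t)=\exp\bigl(Y_i(t)-\tfrac12\operatorname{Var}(Y_i(t))\bigr)$, $1\le i\le d$. Let $\mathbf X(t)=(X_1(t),\dots,X_d(t))$, $t\in\mathbb R^p$, be an associated Brown–Resnick process, i.e. a process with continuous $[0,\infty)^d$-valued sample paths that has the same law as $$\max_{m\ge 1}\Gamma_m^{-1}\mathbf Z^{(m)}(t),\qquad t\in\mathbb R^p \quad\text{(componentwise maximum)},$$ where $\Gamma_m=E_1+\dots+E_m$, the $E_k$ are independent unit exponential random variables, and the $\mathbf Z^{(m)}$ are independent copies of $\mathbf Z=(Z_1,\dots,Z_d)$, independent of $(E_k)_{k\ge1}$. Let $\gamma_{ij}(t,s)=\operatorname{Var}(Y_i(t)-Y_j(s))$ for $s,t\in\mathbb R^p$, $1\le i,j\le d$. (The law of a process is its law on the $\sigma$-field generated by the coordinate projections.) 1. The law of $\mathbf X$ depends only on the functions $\gamma_{ij}$: if $\mathbf X$ and $\mathbf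 X'$ are Brown–Resnick processes associated with $\mathbf Y$ and $\mathbf Y'$, respectively, and $\operatorname{Var}(Y_i(t)-Y_j(s))=\operatorname{Var}(Y'_i(t)-Y'_j(s))$ for all $i,j\le d$ and $s,t\in\mathbb R^p$, then $\mathbf X$ and $\mathbf X'$ have the same law. 2. If every $\gamma_{ij}(t,s)$, $i,j\le d$, depends only on the difference $t-s$, then $\mathbf X$ is stationary, i.e. $(\mathbf X(t-h))_{t\in\mathbb R^p}$ and $(\mathbf X(t))_{t\in\mathbb R^p}$ have the same law for every $h\in\mathbb R^p$. 3. Let $t_1,\dots,t_n\in\mathbb R^p$ and $\mathbf x_j=(x_{1j},\dots,x_{dj})\in(0,\infty)^d$, $1\le j\le n$, and suppose that the random vector $(\mathbf Y(t_1),\dots,\mathbf Y(t_n))$ in $\mathbb R^{dn}$ possesses a density with respect to Lebesgue measure. With $J=\{(i,j):1\le i\le d,\ 1\le j\le n\}$, the probability $\mathbb P(\mathbf X(t_j)\le\mathbf x_j,\ 1\le j\le n)$ is positive and $$-\ln\mathbb P\bigl(\mathbf X(t_j)\le \mathbf x_j,\ 1\le j\le n\bigr)=\sum_{(k,l)\in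 J}\frac1{x_{kl}}\,\mathbb P\Bigl(\forall (i,j)\in J\setminus\{(k,l)\}:\ Y_i(t_j)-Y_k(t_l)-\tfrac12\operatorname{Var}\bigl(Y_i(t_j)-Y_k(t_l)\bigr)\le\ln\frac{x_{ij}}{x_{kl}}\Bigr).$$ -/

import Mathlib

open MeasureTheory ProbabilityTheory

noncomputable section

namespace BrownResnick

/-- The parameter space `ℝᵖ`. -/
abbrev Param (p : ℕ) : Type := EuclideanSpace ℝ (Fin p)

/-- The space of all functions `ℝᵖ → ℝᵈ`, carrying the (product) σ-field generated by the
projections `f ↦ f t`. -/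
abbrev PathSpace (p d : ℕ) : Type := Param p → Fin d → ℝ

/-- The law of an `ℝᵈ`-valued process with index set `ℝᵖ`, on the σ-field generated by the
projections. -/
def processLaw {p d : ℕ} {Ω : Type*} [MeasurableSpace Ω]
    (X : Param p → Ω → Fin d → ℝ) (P : Measure Ω) : Measure (PathSpace p d) :=
  P.map (fun ω t => X t ω)

/-- `X` is a random process all of whose sample paths belong to the space `C` of continuous
functions `ℝᵖ → [0,∞)ᵈ`. -/
structure HasPathsInC {p d : ℕ} {Ω : Type*} [MeasurableSpace Ω]
    (X : Param p → Ω → Fin d → ℝ) : Prop where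
  measurable : ∀ t, Measurable (X t)
  continuous : ∀ ω, Continuous (fun t => X t ω)
  nonneg : ∀ t ω i, 0 ≤ X t ω i

/-- `Γₖ = E₀ + ⋯ + Eₖ`, the partial sums (indices start at `0`). -/
def arrival (e : ℕ → ℝ) (k : ℕ) : ℝ := ∑ j ∈ Finset.range (k + 1), e j

/-- The componentwise maximum `t ↦ maxₖ Γₖ^(-1/α) z⁽ᵏ⁾(t)` as a function of the sequences `(Eₖ)`
and `(z⁽ᵏ⁾)`. The maximum is almost surely finite (and attained) whenever the components of the
spectral process have finite moments of order `α`, as is the case for log-Gaussian ones. -/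
def deHaanMax {p d : ℕ} (α : ℝ) (w : (ℕ → ℝ) × (ℕ → PathSpace p d)) : PathSpace p d :=
  fun t i => ⨆ k : ℕ, arrival w.1 k ^ (-1 / α) * w.2 k t i

lemma measurable_deHaanMax {p d : ℕ} (α : ℝ) :
    Measurable (deHaanMax (p := p) (d := d) α) := by
  refine measurable_pi_lambda _ fun t => measurable_pi_lambda _ fun i => ?_
  refine Measurable.iSup fun k => Measurable.mul ?_ ?_
  · refine Measurable.pow_const ?_ _
    exact Finset.measurable_sum _ fun j _ => (measurable_pi_apply j).comp measurable_fst
  · exact (measurable_pi_apply i).comp ((measurable_pi_apply t).comp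
      ((measurable_pi_apply k).comp measurable_snd))

/-- The law of `maxₖ Γₖ^(-1/α) Z⁽ᵏ⁾(t)`, `t ∈ ℝᵖ`, where the `Eₖ` are independent unit exponential
random variables, independent of the `Z⁽ᵏ⁾`, which are independent processes with law `ν`. -/
def deHaanLaw {p d : ℕ} (α : ℝ) (ν : Measure (PathSpace p d)) : Measure (PathSpace p d) :=
  ((Measure.infinitePi fun _ : ℕ => expMeasure 1).prod
    (Measure.infinitePi fun _ : ℕ => ν)).map (deHaanMax α)

/-- `X` is a max-stable process with paths in `C` and spectral process `Z` (whose paths are in `C`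
too): it has, in distribution, the de Haan representation `X(t) = maxₖ Γₖ^(-1/α) Z⁽ᵏ⁾(t)`. -/
structure IsMaxStableWithSpectralProcess {p d : ℕ} {Ω Ω' : Type*} [MeasurableSpace Ω]
    [MeasurableSpace Ω'] (α : ℝ) (X : Param p → Ω → Fin d → ℝ) (P : Measure Ω)
    (Z : Param p → Ω' → Fin d → ℝ) (Q : Measure Ω') : Prop where
  paths : HasPathsInC X
  spectral_paths : HasPathsInC Z
  law_eq : processLaw X P = deHaanLaw α (processLaw Z Q)

/-- The log-Gaussian process with components `exp (Yᵢ(t) - Var(Yᵢ(t)) / 2)`. -/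
def logGaussian {p d : ℕ} {Ω : Type*} [MeasurableSpace Ω]
    (Y : Param p → Ω → Fin d → ℝ) (Q : Measure Ω) : Param p → Ω → Fin d → ℝ :=
  fun t ω i => Real.exp (Y t ω i - variance (fun ω' => Y t ω' i) Q / 2)

/-- `X` is a Brown–Resnick max-stable process built from the centered Gaussian process `Y`. -/
structure IsBrownResnick {p d : ℕ} {Ω Ω' : Type*} [MeasurableSpace Ω] [MeasurableSpace Ω']
    (X : Param p → Ω → Fin d → ℝ) (P : Measure Ω)
    (Y : Param p → Ω' → Fin d → ℝ) (Q : Measure Ω') : Prop where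
  gaussian : IsGaussianProcess Y Q
  centered : ∀ t i, ∫ ω, Y t ω i ∂Q = 0
  maxStable : IsMaxStableWithSpectralProcess 1 X P (logGaussian Y Q) Q

/-- The cross-variogram `γᵢⱼ(t,s) = Var(Yᵢ(t) - Yⱼ(s))`. -/
def crossVariogram {p d : ℕ} {Ω : Type*} [MeasurableSpace Ω]
    (Y : Param p → Ω → Fin d → ℝ) (Q : Measure Ω) (i j : Fin d) (t s : Param p) : ℝ :=
  variance (fun ω => Y t ω i - Y s ω j) Q

/-- Stationarity: for every `h`, the shifted process `t ↦ X(t - h)` has the same law as `X`. -/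
def IsStationary {p d : ℕ} {Ω : Type*} [MeasurableSpace Ω]
    (X : Param p → Ω → Fin d → ℝ) (P : Measure Ω) : Prop :=
  ∀ h : Param p, processLaw (fun t => X (t - h)) P = processLaw X P

end BrownResnick

end

/-! The first ingredient is the void probability of a marked Poisson process: if `φ ≥ 0` is
integrable, then no mark satisfies `φ(zₖ) > Γₖ` with probability `exp(-E φ)`
(`markedLaw_forall_le`). No point process theory enters. With `T(u) = ν(φ > u)` and `H(s) =
exp(-∫ₛ^∞ T)`, the variable `1{no violation among the first N points} · H(E₀ + ⋯ + E_{N-1})` has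
constant expectation in `N`, because `H` solves the integral equation `H(s) = E[H(s + E)(1 - T(s +
E))]` for a unit exponential `E`. For `N = 0` the expectation is `H(0) = exp(-E φ)`; as `N → ∞` the
sums diverge, `H` tends to 1, and the void probability remains.

Taking for `φ` the maximum of the finitely many `Z(a)/x(a)` yields the joint distribution functions
`exp(-E maxₐ Z(a)/x(a))`.

The second ingredient is the Cameron–Martin formula: weighting by `exp(Xₐ - Var(Xₐ)/2)` amounts to
adding `cov(X_b, Xₐ)` to each `X_b`. Factoring this weight out of the maximum leaves an expectation
involving only the increments `X_b - Xₐ` (`integral_iSup_exp_eq`), whose law is determined by the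
variogram. This gives uniqueness, and stationarity by comparing shifted times. Splitting the maximum
according to where it is attained, and changing measure separately in each piece, gives the explicit
sum (`integral_iSup_exp_eq_sum`); a density excludes ties. -/

noncomputable section

namespace BrownResnick

open Set Filter Topology

/-! ### An integral equation against the exponential law. -/

/-- `exp (-∫ₛ^∞ T)` for `s ≥ 0`. -/
def expNegTail (T : ℝ → ℝ) (s : ℝ) : ℝ :=
  Real.exp ((∫ u in (0 : ℝ)..s, T u) - ∫ u in Ioi 0, T u)

lemma continuous_expNegTail {T : ℝ → ℝ} (hT : Antitone T) : Continuous (expNegTail T) := by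
  refine Real.continuous_exp.comp (Continuous.sub ?_ continuous_const)
  exact intervalIntegral.continuous_primitive (fun a b => hT.intervalIntegrable) 0

lemma expNegTail_nonneg (T : ℝ → ℝ) (s : ℝ) : 0 ≤ expNegTail T s := (Real.exp_pos _).le

lemma expNegTail_le_one {T : ℝ → ℝ} (hT0 : ∀ u, 0 ≤ T u) (hint : IntegrableOn T (Ioi 0)) {s : ℝ}
    (hs : 0 ≤ s) : expNegTail T s ≤ 1 := by
  rw [expNegTail, Real.exp_le_one_iff, sub_nonpos, intervalIntegral.integral_of_le hs]
  exact setIntegral_mono_set hint (Eventually.of_forall hT0)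
    (LE.le.eventuallyLE Ioc_subset_Ioi_self)

lemma tendsto_expNegTail {T : ℝ → ℝ} (hint : IntegrableOn T (Ioi 0)) :
    Tendsto (expNegTail T) atTop (𝓝 1) := by
  have h := (intervalIntegral_tendsto_integral_Ioi 0 hint tendsto_id).sub_const
    (∫ u in Ioi 0, T u)
  rw [sub_self] at h
  have h2 := (Real.continuous_exp.tendsto 0).comp h
  rwa [Real.exp_zero] at h2

/-- Since `H' = H T`, the integrand is the derivative of `-exp(-e) H(s + e)`, which is `-H(s)` at `e
= 0` and vanishes at infinity. A monotone `T` may jump, so differentiability holds only off a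
countable set; continuity of the primitive suffices there. -/
lemma integral_expNegTail {T : ℝ → ℝ} (hT : Antitone T) (hT0 : ∀ u, 0 ≤ T u) (hT1 : ∀ u, T u ≤ 1)
    (hint : IntegrableOn T (Ioi 0)) {s : ℝ} (hs : 0 ≤ s) :
    IntegrableOn (fun e => Real.exp (-e) * (expNegTail T (s + e) * (1 - T (s + e)))) (Ioi 0) ∧
    ∫ e in Ioi 0, Real.exp (-e) * (expNegTail T (s + e) * (1 - T (s + e))) = expNegTail T s := by
  have hmeas : Measurable fun e => Real.exp (-e) * (expNegTail T (s + e) * (1 - T (s + e))) := by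
    have h1 := (continuous_expNegTail hT).measurable
    have h2 := hT.measurable
    fun_prop
  have hI : IntegrableOn
      (fun e => Real.exp (-e) * (expNegTail T (s + e) * (1 - T (s + e)))) (Ioi 0) := by
    have h0 : IntegrableOn (fun e : ℝ => Real.exp (-e)) (Ioi 0) := integrableOn_exp_neg_Ioi 0
    refine Integrable.mono' h0 hmeas.aestronglyMeasurable ?_
    filter_upwards [ae_restrict_mem measurableSet_Ioi] with e he
    have hse : 0 ≤ s + e := add_nonneg hs (le_of_lt he)
    rw [Real.norm_of_nonneg (mul_nonneg (Real.exp_pos _).le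
      (mul_nonneg (expNegTail_nonneg _ _) (sub_nonneg.2 (hT1 _))))]
    refine mul_le_of_le_one_right (Real.exp_pos _).le ?_
    exact mul_le_one₀ (expNegTail_le_one hT0 hint hse) (sub_nonneg.2 (hT1 _))
      (sub_le_self _ (hT0 _))
  refine ⟨hI, ?_⟩
  set F : ℝ → ℝ := fun e => -(Real.exp (-e) * expNegTail T (s + e)) with hF
  have hFc : Continuous F := by
    have h1 := continuous_expNegTail hT
    fun_prop
  have hFlim : Tendsto F atTop (𝓝 0) := by
    have h1 : Tendsto (fun e : ℝ => Real.exp (-e)) atTop (𝓝 0) :=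
      Real.tendsto_exp_neg_atTop_nhds_zero
    have h2 : Tendsto (fun e : ℝ => expNegTail T (s + e)) atTop (𝓝 1) :=
      (tendsto_expNegTail hint).comp (tendsto_atTop_add_const_left _ _ tendsto_id)
    simpa using (h1.mul h2).neg
  have hder : ∀ e, ContinuousAt T (s + e) →
      HasDerivAt F (Real.exp (-e) * (expNegTail T (s + e) * (1 - T (s + e)))) e := by
    intro e he
    have h1 : HasDerivAt (fun u => ∫ x in (0 : ℝ)..u, T x) (T (s + e)) (s + e) :=
      intervalIntegral.integral_hasDerivAt_right hT.intervalIntegrable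
        hT.measurable.stronglyMeasurable.stronglyMeasurableAtFilter he
    have h2 := (h1.sub_const (∫ u in Ioi 0, T u)).exp
    have h3 : HasDerivAt (fun e => expNegTail T (s + e)) (expNegTail T (s + e) * T (s + e)) e := by
      simpa [expNegTail] using! HasDerivAt.comp_const_add s e h2
    have h4 : HasDerivAt (fun e : ℝ => Real.exp (-e)) (-Real.exp (-e)) e := by
      simpa using! (hasDerivAt_neg e).exp
    convert! (h4.mul h3).neg using 1
    ring
  have hcount : {e : ℝ | ¬ ContinuousAt T (s + e)}.Countable :=
    hT.countable_not_continuousAt.preimage (add_right_injective s)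
  have key : ∀ b, 0 ≤ b →
      ∫ e in (0 : ℝ)..b, Real.exp (-e) * (expNegTail T (s + e) * (1 - T (s + e))) = F b - F 0 := by
    intro b hb
    refine integral_eq_of_hasDerivAt_off_countable_of_le F _ hb hcount hFc.continuousOn ?_ ?_
    · intro x hx
      exact hder x (not_not.1 hx.2)
    · rw [intervalIntegrable_iff_integrableOn_Ioc_of_le hb]
      exact hI.mono_set Ioc_subset_Ioi_self
  refine tendsto_nhds_unique (intervalIntegral_tendsto_integral_Ioi 0 hI tendsto_id) ?_
  have h5 : Tendsto (fun b => F b - F 0) atTop (𝓝 (expNegTail T s)) := by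
    simpa [hF] using hFlim.sub_const (F 0)
  refine h5.congr' ?_
  filter_upwards [eventually_ge_atTop 0] with b hb
  exact (key b hb).symm

instance isProbabilityMeasure_expMeasure_one : IsProbabilityMeasure (expMeasure 1) :=
  isProbabilityMeasure_expMeasure one_pos

lemma lintegral_expMeasure_one {f : ℝ → ENNReal} (hf : Measurable f) :
    ∫⁻ e, f e ∂expMeasure 1 = ∫⁻ e in Ioi 0, ENNReal.ofReal (Real.exp (-e)) * f e := by
  have h : expMeasure 1 = volume.withDensity (exponentialPDF 1) := rfl
  have hm : Measurable (exponentialPDF 1) := (measurable_exponentialPDFReal 1).ennreal_ofReal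
  rw [h, lintegral_withDensity_eq_lintegral_mul _ hm hf,
    ← lintegral_add_compl _ (measurableSet_Ici (a := (0 : ℝ)))]
  have h1 : ∫⁻ e in (Ici (0 : ℝ))ᶜ, (exponentialPDF 1 * f) e = 0 := by
    rw [setLIntegral_congr_fun (g := fun _ => 0) measurableSet_Ici.compl, lintegral_zero]
    intro e he
    simp [exponentialPDF_of_neg (r := 1) (not_le.1 he)]
  rw [h1, add_zero, setLIntegral_congr Ioi_ae_eq_Ici.symm]
  refine setLIntegral_congr_fun measurableSet_Ioi fun e he => ?_
  simp [exponentialPDF_of_nonneg (r := 1) (le_of_lt he)]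

lemma ae_pos_expMeasure_one : ∀ᵐ e ∂expMeasure 1, 0 < e := by
  have h := lintegral_expMeasure_one (f := (Iic (0 : ℝ)).indicator 1)
    (measurable_one.indicator measurableSet_Iic)
  rw [lintegral_indicator_one measurableSet_Iic] at h
  have h2 : {e : ℝ | ¬ 0 < e} = Iic 0 := by ext; simp
  rw [ae_iff, h2, h, setLIntegral_congr_fun (g := fun _ => 0) measurableSet_Ioi, lintegral_zero]
  intro e he
  simp [not_le.2 (mem_Ioi.1 he)]

lemma lintegral_expNegTail {T : ℝ → ℝ} (hT : Antitone T) (hT0 : ∀ u, 0 ≤ T u)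
    (hT1 : ∀ u, T u ≤ 1) (hint : IntegrableOn T (Ioi 0)) {s : ℝ} (hs : 0 ≤ s) :
    ∫⁻ e, ENNReal.ofReal (expNegTail T (s + e) * (1 - T (s + e))) ∂expMeasure 1 =
      ENNReal.ofReal (expNegTail T s) := by
  have h1 := (continuous_expNegTail hT).measurable
  have h2 := hT.measurable
  obtain ⟨hI, hval⟩ := integral_expNegTail hT hT0 hT1 hint hs
  rw [lintegral_expMeasure_one (by fun_prop), ← hval,
    ofReal_integral_eq_lintegral_ofReal hI (Eventually.of_forall fun e =>
      mul_nonneg (Real.exp_pos _).le (mul_nonneg (expNegTail_nonneg _ _) (sub_nonneg.2 (hT1 _))))]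
  refine lintegral_congr fun e => ?_
  rw [ENNReal.ofReal_mul (Real.exp_pos _).le]

/-! ### Independence of the next point from the past. -/

/-- The sequence `w` with the terms from the `N`-th on replaced by `c`. -/
def truncate {α : Type*} (c : α) (N : ℕ) (w : ℕ → α) (k : ℕ) : α := if k < N then w k else c

lemma measurable_truncate {α : Type*} [MeasurableSpace α] (c : α) (N : ℕ) :
    Measurable (truncate c N) := by
  refine measurable_pi_lambda _ fun k => ?_
  unfold truncate
  split_ifs
  · exact measurable_pi_apply k
  · exact measurable_const

/-- The past is encoded as a full sequence with a constant tail, so that functions of the past keep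
the same domain for every `N`. -/
lemma map_truncate_prod {α : Type*} [MeasurableSpace α] (ν : Measure α) [IsProbabilityMeasure ν]
    (c : α) (N : ℕ) :
    (Measure.infinitePi fun _ : ℕ => ν).map (fun w => (truncate c N w, w N)) =
      ((Measure.infinitePi fun _ : ℕ => ν).map (truncate c N)).prod ν := by
  have hind : iIndepFun (fun (k : ℕ) (w : ℕ → α) => w k) (Measure.infinitePi fun _ : ℕ => ν) :=
    iIndepFun_infinitePi (X := fun _ x => x) fun _ => measurable_id
  have h := hind.indepFun_finset (Finset.range N) {N} (by simp) (fun _ => measurable_pi_apply _)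
  let f : (Finset.range N → α) → ℕ → α := fun x k =>
    if h : k ∈ Finset.range N then x ⟨k, h⟩ else c
  have hf : Measurable f := by
    refine measurable_pi_lambda _ fun k => ?_
    by_cases hk : k ∈ Finset.range N
    · simpa [f, Finset.mem_range.1 hk] using! measurable_pi_apply (⟨k, hk⟩ : Finset.range N)
    · simp [f, mt Finset.mem_range.2 hk]
  have h2 := h.comp hf (measurable_pi_apply (⟨N, by simp⟩ : ({N} : Finset ℕ)))
  have h3 : IndepFun (truncate c N) (fun w => w N) (Measure.infinitePi fun _ : ℕ => ν) := by
    convert! h2 using 1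
    ext w k
    simp [f, truncate]
  rw [(indepFun_iff_map_prod_eq_prod_map_map (measurable_truncate c N).aemeasurable
    (measurable_pi_apply N).aemeasurable).1 h3, Measure.infinitePi_map_eval]

/-! ### Void probabilities of a marked Poisson process. -/

section Poisson

variable {S : Type*} [MeasurableSpace S]

/-- The law of an i.i.d. sequence of unit exponential variables and an independent i.i.d. sequence
with law `ν`. -/
abbrev markedLaw (ν : Measure S) : Measure ((ℕ → ℝ) × (ℕ → S)) :=
  (Measure.infinitePi fun _ : ℕ => expMeasure 1).prod (Measure.infinitePi fun _ : ℕ => ν)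

/-- Conditioning on the first `N` points. The hypothesis `htr` says that `F` sees only those points,
so the point with index `N` is independent of them and can be integrated out first. -/
lemma lintegral_markedLaw_split (ν : Measure S) [IsProbabilityMeasure ν] (c : S) (N : ℕ)
    (F : (ℕ → ℝ) → (ℕ → S) → ℝ → S → ENNReal)
    (hF : Measurable fun q : ((ℕ → ℝ) × ℝ) × ((ℕ → S) × S) => F q.1.1 q.2.1 q.1.2 q.2.2)
    (htr : ∀ w z, F (truncate 0 N w) (truncate c N z) = F w z) :
    ∫⁻ w, F w.1 w.2 (w.1 N) (w.2 N) ∂markedLaw ν =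
      ∫⁻ w, ∫⁻ e, ∫⁻ z, F w.1 w.2 e z ∂ν ∂expMeasure 1 ∂markedLaw ν := by
  have m1 := measurable_truncate (0 : ℝ) N
  have m2 := measurable_truncate c N
  set g : (ℕ → ℝ) × (ℕ → S) → ((ℕ → ℝ) × ℝ) × ((ℕ → S) × S) :=
    Prod.map (fun w => (truncate 0 N w, w N)) (fun z => (truncate c N z, z N)) with hg
  have hgm1 : Measurable fun w : ℕ → ℝ => (truncate 0 N w, w N) := by fun_prop
  have hgm2 : Measurable fun w : ℕ → S => (truncate c N w, w N) := by fun_prop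
  have hgm : Measurable g := hgm1.prodMap hgm2
  have hmap : (markedLaw ν).map g =
      (((Measure.infinitePi fun _ : ℕ => expMeasure 1).map (truncate 0 N)).prod
        (expMeasure 1)).prod
      (((Measure.infinitePi fun _ : ℕ => ν).map (truncate c N)).prod ν) := by
    rw [← map_truncate_prod, ← map_truncate_prod, hg, ← Measure.map_prod_map _ _ hgm1 hgm2]
  have p1 : IsProbabilityMeasure ((Measure.infinitePi fun _ : ℕ => expMeasure 1).map
      (truncate 0 N)) := Measure.isProbabilityMeasure_map m1.aemeasurable
  have p2 : IsProbabilityMeasure ((Measure.infinitePi fun _ : ℕ => ν).map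
      (truncate c N)) := Measure.isProbabilityMeasure_map m2.aemeasurable
  have hmap2 : (markedLaw ν).map (Prod.map (truncate 0 N) (truncate c N)) =
      ((Measure.infinitePi fun _ : ℕ => expMeasure 1).map (truncate 0 N)).prod
      ((Measure.infinitePi fun _ : ℕ => ν).map (truncate c N)) := by
    rw [← Measure.map_prod_map _ _ m1 m2]
  have hF3 : Measurable fun q : ((ℕ → ℝ) × (ℕ → S)) × (ℝ × S) => F q.1.1 q.1.2 q.2.1 q.2.2 :=
    hF.comp (by fun_prop : Measurable fun q : ((ℕ → ℝ) × (ℕ → S)) × (ℝ × S) =>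
      ((q.1.1, q.2.1), (q.1.2, q.2.2)))
  have hF2 : Measurable fun q : (ℕ → ℝ) × (ℕ → S) =>
      ∫⁻ e, ∫⁻ z, F q.1 q.2 e z ∂ν ∂expMeasure 1 := by
    refine Measurable.lintegral_prod_right'
      (f := fun q : ((ℕ → ℝ) × (ℕ → S)) × ℝ => ∫⁻ z, F q.1.1 q.1.2 q.2 z ∂ν) ?_
    refine Measurable.lintegral_prod_right'
      (f := fun q : (((ℕ → ℝ) × (ℕ → S)) × ℝ) × S => F q.1.1.1 q.1.1.2 q.1.2 q.2) ?_
    exact hF3.comp (f := fun q : (((ℕ → ℝ) × (ℕ → S)) × ℝ) × S => (q.1.1, (q.1.2, q.2)))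
      (by fun_prop)
  calc ∫⁻ w, F w.1 w.2 (w.1 N) (w.2 N) ∂markedLaw ν
      = ∫⁻ w, (fun q : ((ℕ → ℝ) × ℝ) × ((ℕ → S) × S) => F q.1.1 q.2.1 q.1.2 q.2.2) (g w)
          ∂markedLaw ν := by simp [hg, htr]
    _ = ∫⁻ x, ∫⁻ e, ∫⁻ y, ∫⁻ z, F x y e z ∂ν
          ∂((Measure.infinitePi fun _ : ℕ => ν).map (truncate c N)) ∂expMeasure 1
          ∂((Measure.infinitePi fun _ : ℕ => expMeasure 1).map (truncate 0 N)) := by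
        rw [← lintegral_map hF hgm, hmap, lintegral_prod _ hF.aemeasurable,
          lintegral_prod _ (hF.lintegral_prod_right').aemeasurable]
        refine lintegral_congr fun x => lintegral_congr fun e => ?_
        rw [lintegral_prod]
        exact (hF.comp (by fun_prop : Measurable fun q : (ℕ → S) × S =>
          ((x, e), q))).aemeasurable
    _ = ∫⁻ x, ∫⁻ y, ∫⁻ e, ∫⁻ z, F x y e z ∂ν ∂expMeasure 1
          ∂((Measure.infinitePi fun _ : ℕ => ν).map (truncate c N))
          ∂((Measure.infinitePi fun _ : ℕ => expMeasure 1).map (truncate 0 N)) := by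
        refine lintegral_congr fun x => lintegral_lintegral_swap ?_
        refine Measurable.aemeasurable ?_
        refine Measurable.lintegral_prod_right'
          (f := fun q : (ℝ × (ℕ → S)) × S => F x q.1.2 q.1.1 q.2) ?_
        exact hF.comp (f := fun q : (ℝ × (ℕ → S)) × S => ((x, q.1.1), (q.1.2, q.2)))
          (by fun_prop)
    _ = ∫⁻ q, ∫⁻ e, ∫⁻ z, F q.1 q.2 e z ∂ν ∂expMeasure 1
          ∂((markedLaw ν).map (Prod.map (truncate 0 N) (truncate c N))) := by
        rw [hmap2, lintegral_prod _ hF2.aemeasurable]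
    _ = _ := by
        rw [lintegral_map hF2 (m1.prodMap m2)]
        simp [htr]

lemma ae_pos_markedLaw (ν : Measure S) [IsProbabilityMeasure ν] :
    ∀ᵐ w ∂markedLaw ν, ∀ k, 0 < w.1 k := by
  rw [ae_all_iff]
  intro k
  have h1 : Measure.QuasiMeasurePreserving (fun w : (ℕ → ℝ) × (ℕ → S) => w.1 k) (markedLaw ν)
      (expMeasure 1) :=
    (measurePreserving_eval_infinitePi (fun _ : ℕ => expMeasure 1) k).quasiMeasurePreserving.comp
      Measure.quasiMeasurePreserving_fst
  exact h1.ae ae_pos_expMeasure_one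

lemma ae_tendsto_sum_markedLaw (ν : Measure S) [IsProbabilityMeasure ν] :
    ∀ᵐ w ∂markedLaw ν, Tendsto (fun N => ∑ j ∈ Finset.range N, w.1 j) atTop atTop := by
  -- Capping at 1 makes integrability trivial; positivity of the mean is all that the law of large
  -- numbers has to supply.
  have hind : iIndepFun (fun (k : ℕ) (w : ℕ → ℝ) => min (w k) 1)
      (Measure.infinitePi fun _ : ℕ => expMeasure 1) :=
    iIndepFun_infinitePi (X := fun _ (x : ℝ) => min x 1) fun _ => by fun_prop
  have hpos : ∀ᵐ e ∂expMeasure 1, 0 < min e 1 := by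
    filter_upwards [ae_pos_expMeasure_one] with e he
    exact lt_min he one_pos
  have hint1 : Integrable (fun e : ℝ => min e 1) (expMeasure 1) := by
    refine Integrable.of_bound (by fun_prop) 1 ?_
    filter_upwards [hpos] with e he
    rw [Real.norm_of_nonneg he.le]
    exact min_le_right _ _
  have hmp := fun k => measurePreserving_eval_infinitePi (fun _ : ℕ => expMeasure 1) k
  have hmin : ∀ k, Measurable fun w : ℕ → ℝ => min (w k) 1 := fun k => by fun_prop
  have hslln := strong_law_ae_real (μ := Measure.infinitePi fun _ : ℕ => expMeasure 1)
    (fun (k : ℕ) (w : ℕ → ℝ) => min (w k) 1)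
    ((hmp 0).integrable_comp_of_integrable hint1)
    (fun i j hij => hind.indepFun hij) (fun i => ⟨(hmin i).aemeasurable, (hmin 0).aemeasurable, by
      have h1 := fun k => Measure.map_map (g := fun e : ℝ => min e 1) (f := Function.eval k)
        (μ := Measure.infinitePi fun _ : ℕ => expMeasure 1) (by fun_prop) (by fun_prop)
      have h2 := h1 i
      have h3 := h1 0
      rw [(hmp _).map_eq] at h2 h3
      exact h2.symm.trans h3⟩)
  have hm : 0 < ∫ w, min (w 0) 1 ∂(Measure.infinitePi fun _ : ℕ => expMeasure 1) := by
    have h1 : ∫ w, min (w 0) 1 ∂(Measure.infinitePi fun _ : ℕ => expMeasure 1) =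
        ∫ e, min e 1 ∂expMeasure 1 := by
      have h2 := integral_map (μ := Measure.infinitePi fun _ : ℕ => expMeasure 1)
        (f := fun e : ℝ => min e 1) (hmp 0).measurable.aemeasurable
        (by fun_prop)
      rw [(hmp 0).map_eq] at h2
      exact h2.symm
    rw [h1, integral_pos_iff_support_of_nonneg_ae (hpos.mono fun _ h => h.le) hint1]
    have h2 : (expMeasure 1) (Function.support fun e : ℝ => min e 1) = 1 := by
      rw [← prob_compl_eq_zero_iff (measurableSet_support (by fun_prop)), ← nonpos_iff_eq_zero]
      refine (measure_mono ?_).trans (ae_iff.1 hpos).le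
      intro e he
      simp only [mem_compl_iff, Function.mem_support, not_not] at he
      exact fun h => h.ne' he
    rw [h2]
    exact one_pos
  have hfst := (Measure.quasiMeasurePreserving_fst (μ := Measure.infinitePi fun _ : ℕ =>
    expMeasure 1) (ν := Measure.infinitePi fun _ : ℕ => ν)).ae hslln
  filter_upwards [hfst] with w hw
  have h1 := hw.pos_mul_atTop hm tendsto_natCast_atTop_atTop
  refine tendsto_atTop_mono' _ ?_ h1
  filter_upwards [eventually_gt_atTop 0] with N hN
  rw [div_mul_cancel₀ _ (Nat.cast_ne_zero.2 hN.ne')]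
  exact Finset.sum_le_sum fun j _ => min_le_left _ _

/-- The probability that no point `(Γₖ, φ(zₖ))` of a marked Poisson process lies above the
diagonal. -/
theorem markedLaw_forall_le (ν : Measure S) [IsProbabilityMeasure ν] {φ : S → ℝ}
    (hφ : Measurable φ) (hφ0 : 0 ≤ᵐ[ν] φ) (hint : Integrable φ ν) :
    markedLaw ν {w | ∀ k, φ (w.2 k) ≤ arrival w.1 k} = ENNReal.ofReal (Real.exp (-∫ z, φ z ∂ν)) := by
  set T : ℝ → ℝ := fun u => ν.real {z | u < φ z} with hTdef
  have hT : Antitone T := fun u v huv =>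
    measureReal_mono (fun z (hz : v < φ z) => lt_of_le_of_lt huv hz)
  have hT0 : ∀ u, 0 ≤ T u := fun u => measureReal_nonneg
  have hT1 : ∀ u, T u ≤ 1 := fun u => measureReal_le_one
  have hTc : ∀ u, ν {z | φ z ≤ u} = ENNReal.ofReal (1 - T u) := by
    intro u
    have h1 : {z | φ z ≤ u} = {z | u < φ z}ᶜ := by ext; simp
    rw [h1, prob_compl_eq_one_sub (measurableSet_lt measurable_const hφ),
      ENNReal.ofReal_sub _ (hT0 u), ENNReal.ofReal_one, hTdef, ofReal_measureReal]
  have hTint : IntegrableOn T (Ioi 0) := by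
    refine ⟨hT.measurable.aestronglyMeasurable, ?_⟩
    rw [hasFiniteIntegral_iff_ofReal (Eventually.of_forall hT0)]
    have h1 := lintegral_eq_lintegral_meas_lt ν hφ0 hφ.aemeasurable
    have h2 : ∫⁻ u in Ioi 0, ENNReal.ofReal (T u) = ∫⁻ u in Ioi 0, ν {z | u < φ z} := by
      simp [hTdef]
    rw [h2, ← h1]
    exact hint.lintegral_lt_top
  have hE : ∫ z, φ z ∂ν = ∫ u in Ioi 0, T u := hint.integral_eq_integral_meas_lt hφ0
  obtain ⟨c⟩ : Nonempty S := nonempty_of_isProbabilityMeasure ν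
  have hH := (continuous_expNegTail hT).measurable
  let A : ℕ → Set ((ℕ → ℝ) × (ℕ → S)) := fun N => {w | ∀ k < N, φ (w.2 k) ≤ arrival w.1 k}
  have harr : ∀ k, Measurable fun w : ℕ → ℝ => arrival w k := fun k => by
    unfold arrival; fun_prop
  have hAm : ∀ N, MeasurableSet (A N) := by
    intro N
    have h1 : A N = ⋂ k, ⋂ (_ : k < N), {w | φ (w.2 k) ≤ arrival w.1 k} := by ext; simp [A]
    rw [h1]
    refine MeasurableSet.iInter fun k => MeasurableSet.iInter fun _ => ?_
    have := harr k
    exact measurableSet_le (by fun_prop) (by fun_prop)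
  -- The process whose expectation does not depend on `N`: the second factor plays the role of the
  -- conditional probability that the points still to come cause no violation.
  let h : ℕ → (ℕ → ℝ) × (ℕ → S) → ENNReal := fun N w =>
    (A N).indicator 1 w * ENNReal.ofReal (expNegTail T (∑ j ∈ Finset.range N, w.1 j))
  have hhm : ∀ N, Measurable (h N) := fun N =>
    (measurable_one.indicator (hAm N)).mul (by fun_prop)
  have hstep : ∀ N, ∫⁻ w, h (N + 1) w ∂markedLaw ν = ∫⁻ w, h N w ∂markedLaw ν := by
    intro N
    let F : (ℕ → ℝ) → (ℕ → S) → ℝ → S → ENNReal := fun w z e y =>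
      (A N).indicator 1 (w, z) *
        ({q : ℝ × S | φ q.2 ≤ q.1}.indicator 1 (∑ j ∈ Finset.range N, w j + e, y) *
          ENNReal.ofReal (expNegTail T (∑ j ∈ Finset.range N, w j + e)))
    have hBm : MeasurableSet {q : ℝ × S | φ q.2 ≤ q.1} :=
      measurableSet_le (by fun_prop) (by fun_prop)
    have hF : Measurable fun q : ((ℕ → ℝ) × ℝ) × ((ℕ → S) × S) => F q.1.1 q.2.1 q.1.2 q.2.2 := by
      refine Measurable.mul ?_ (Measurable.mul ?_ ?_)
      · exact (measurable_one.indicator (hAm N)).comp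
          (by fun_prop : Measurable fun q : ((ℕ → ℝ) × ℝ) × ((ℕ → S) × S) => (q.1.1, q.2.1))
      · exact (measurable_one.indicator hBm).comp
          (by fun_prop : Measurable fun q : ((ℕ → ℝ) × ℝ) × ((ℕ → S) × S) =>
            (∑ j ∈ Finset.range N, q.1.1 j + q.1.2, q.2.2))
      · fun_prop
    have htr1 : ∀ w : ℕ → ℝ, ∀ k ≤ N, ∑ j ∈ Finset.range k, truncate 0 N w j =
        ∑ j ∈ Finset.range k, w j := fun w k hk =>
      Finset.sum_congr rfl fun j hj => by
        simp [truncate, (Finset.mem_range.1 hj).trans_le hk]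
    have htr : ∀ w z, F (truncate 0 N w) (truncate c N z) = F w z := by
      intro w z
      have h1 : ((truncate 0 N w, truncate c N z) ∈ A N) ↔ (w, z) ∈ A N := by
        refine forall₂_congr fun k hk => ?_
        simp only [arrival, htr1 w (k + 1) hk]
        simp [truncate, hk]
      ext e y
      simp only [F, htr1 w N le_rfl, indicator_apply, h1, Pi.one_apply]
    have h1 : ∀ w, h (N + 1) w = F w.1 w.2 (w.1 N) (w.2 N) := by
      intro w
      -- `arrival` at index `N` already contains `N + 1` terms, so the new constraint involves the
      -- past sum plus the fresh variable.
      have h2 : w ∈ A (N + 1) ↔ w ∈ A N ∧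
          φ (w.2 N) ≤ ∑ j ∈ Finset.range N, w.1 j + w.1 N := by
        rw [← Finset.sum_range_succ]
        exact Nat.forall_lt_succ_right
      by_cases h3 : w ∈ A N <;>
        by_cases h4 : φ (w.2 N) ≤ ∑ j ∈ Finset.range N, w.1 j + w.1 N <;>
          simp [h, F, indicator_apply, h2, h3, h4, Finset.sum_range_succ]
    rw [lintegral_congr h1, lintegral_markedLaw_split ν c N F hF htr]
    refine lintegral_congr_ae ?_
    filter_upwards [ae_pos_markedLaw ν] with w hw
    have hs : 0 ≤ ∑ j ∈ Finset.range N, w.1 j := Finset.sum_nonneg fun j _ => (hw j).le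
    have h2 : ∀ e, ∫⁻ y, F w.1 w.2 e y ∂ν = (A N).indicator 1 w *
        ENNReal.ofReal (expNegTail T (∑ j ∈ Finset.range N, w.1 j + e) *
          (1 - T (∑ j ∈ Finset.range N, w.1 j + e))) := by
      intro e
      set s := ∑ j ∈ Finset.range N, w.1 j + e with hsdef
      have h3 : Measurable fun y => {q : ℝ × S | φ q.2 ≤ q.1}.indicator (1 : ℝ × S → ENNReal) (s, y) :=
        (measurable_one.indicator hBm).comp (by fun_prop)
      have h4 : ∫⁻ y, {q : ℝ × S | φ q.2 ≤ q.1}.indicator (1 : ℝ × S → ENNReal) (s, y) ∂ν =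
          ν {z | φ z ≤ s} := by
        rw [← lintegral_indicator_one (measurableSet_le hφ measurable_const)]
        rfl
      simp only [F, ← hsdef]
      rw [lintegral_const_mul _ (h3.mul_const _), lintegral_mul_const _ h3, h4, hTc,
        mul_comm (ENNReal.ofReal (1 - _)), ENNReal.ofReal_mul (expNegTail_nonneg _ _)]
    have h5 := hT.measurable
    simp_rw [h2]
    rw [lintegral_const_mul _ (by fun_prop), lintegral_expNegTail hT hT0 hT1 hTint hs]
  have hconst : ∀ N, ∫⁻ w, h N w ∂markedLaw ν = ENNReal.ofReal (Real.exp (-∫ z, φ z ∂ν)) := by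
    intro N
    induction N with
    | zero => simp [h, A, expNegTail, hE]
    | succ N ih => rw [hstep, ih]
  have hAall : MeasurableSet {w : (ℕ → ℝ) × (ℕ → S) | ∀ k, φ (w.2 k) ≤ arrival w.1 k} := by
    rw [ofPred_forall]
    refine MeasurableSet.iInter fun k => ?_
    have := harr k
    exact measurableSet_le (by fun_prop) (by fun_prop)
  have hlim : Tendsto (fun N => ∫⁻ w, h N w ∂markedLaw ν) atTop
      (𝓝 (∫⁻ w, {w : (ℕ → ℝ) × (ℕ → S) | ∀ k, φ (w.2 k) ≤ arrival w.1 k}.indicator 1 w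
        ∂markedLaw ν)) := by
    refine tendsto_lintegral_of_dominated_convergence (fun _ => 1) hhm ?_ (by simp) ?_
    · intro N
      filter_upwards [ae_pos_markedLaw ν] with w hw
      refine mul_le_one' (indicator_le_self' (by simp) w) ?_
      rw [ENNReal.ofReal_le_one]
      exact expNegTail_le_one hT0 hTint (Finset.sum_nonneg fun j _ => (hw j).le)
    · filter_upwards [ae_tendsto_sum_markedLaw ν] with w hw
      by_cases hwA : ∀ k, φ (w.2 k) ≤ arrival w.1 k
      · have h1 := ENNReal.tendsto_ofReal ((tendsto_expNegTail hTint).comp hw)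
        rw [ENNReal.ofReal_one] at h1
        have h2 : ∀ N, w ∈ A N := fun N k _ => hwA k
        simpa [h, indicator_apply, hwA, h2] using! h1
      -- A violation at index `k` makes the sequence vanish from `N = k + 1` on.
      · obtain ⟨k, hk⟩ := not_forall.1 hwA
        refine tendsto_const_nhds.congr' ?_
        filter_upwards [eventually_gt_atTop k] with N hN
        have h2 : w ∉ A N := fun h3 => hk (h3 k hN)
        simp [h, indicator_apply, hwA, h2]
  rw [lintegral_indicator_one hAall] at hlim
  simp_rw [hconst] at hlim
  exact tendsto_nhds_unique hlim tendsto_const_nhds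

end Poisson

variable {p d : ℕ}

/-- Almost sure finiteness of `sup φ(zₖ)/Γₖ`: the bound `n + 1` works with probability at least
`exp(-E φ/(n + 1))`, which tends to 1. -/
lemma ae_exists_forall_le_mul_arrival {S : Type*} [MeasurableSpace S] (ν : Measure S)
    [IsProbabilityMeasure ν] {φ : S → ℝ} (hφ : Measurable φ) (hφ0 : 0 ≤ᵐ[ν] φ)
    (hint : Integrable φ ν) :
    ∀ᵐ w ∂markedLaw ν, ∃ c : ℝ, ∀ k, φ (w.2 k) ≤ c * arrival w.1 k := by
  have hn : ∀ n : ℕ, ENNReal.ofReal (Real.exp (-((∫ z, φ z ∂ν) / ((n : ℝ) + 1)))) ≤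
      markedLaw ν (⋃ n : ℕ, {w | ∀ k, φ (w.2 k) / ((n : ℝ) + 1) ≤ arrival w.1 k}) := by
    intro n
    rw [← integral_div, ← markedLaw_forall_le ν (φ := fun z => φ z / ((n : ℝ) + 1))
      (by fun_prop) (by filter_upwards [hφ0] with z hz using div_nonneg hz (by positivity))
      (hint.div_const _)]
    exact measure_mono (subset_iUnion
      (fun n : ℕ => {w : (ℕ → ℝ) × (ℕ → S) | ∀ k, φ (w.2 k) / ((n : ℝ) + 1) ≤ arrival w.1 k}) n)
  have hlim : Tendsto (fun n : ℕ => ENNReal.ofReal (Real.exp (-((∫ z, φ z ∂ν) / ((n : ℝ) + 1)))))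
      atTop (𝓝 1) := by
    have h1 : Tendsto (fun n : ℕ => (∫ z, φ z ∂ν) / ((n : ℝ) + 1)) atTop (𝓝 0) :=
      tendsto_const_nhds.div_atTop
        (tendsto_atTop_add_const_right _ _ tendsto_natCast_atTop_atTop)
    have h2 := ENNReal.tendsto_ofReal ((Real.continuous_exp.tendsto _).comp h1.neg)
    simpa using! h2
  have hone := le_of_tendsto' hlim hn
  have hm : MeasurableSet (⋃ n : ℕ, {w : (ℕ → ℝ) × (ℕ → S) |
      ∀ k, φ (w.2 k) / ((n : ℝ) + 1) ≤ arrival w.1 k}) := by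
    refine MeasurableSet.iUnion fun n => ?_
    rw [ofPred_forall]
    refine MeasurableSet.iInter fun k => measurableSet_le (by fun_prop) ?_
    unfold arrival
    fun_prop
  have hae := (mem_ae_iff_prob_eq_one hm).2 (le_antisymm prob_le_one hone)
  filter_upwards [hae] with w hw
  obtain ⟨n, hn⟩ := mem_iUnion.1 hw
  refine ⟨(n : ℝ) + 1, fun k => ?_⟩
  have := hn k
  rwa [div_le_iff₀' (by positivity)] at this

/-! ### Joint distribution functions of de Haan maxima. -/

section MaxFunctional

variable {ι : Type*} [Finite ι]

lemma measurable_iSup_div (τ : ι → Param p) (c : ι → Fin d) (x : ι → ℝ) :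
    Measurable fun z : PathSpace p d => ⨆ a, z (τ a) (c a) / x a := by
  refine Measurable.iSup fun a => Measurable.div_const ?_ _
  exact (measurable_pi_apply (c a)).comp (measurable_pi_apply (τ a))

/-- Nonnegativity of `y` covers the empty index set, where the real supremum is 0. -/
lemma iSup_le_iff_of_nonneg {f : ι → ℝ} {y : ℝ} (hy : 0 ≤ y) : ⨆ a, f a ≤ y ↔ ∀ a, f a ≤ y :=
  ⟨fun h a => (le_ciSup (Set.finite_range f).bddAbove a).trans h, fun h => Real.iSup_le h hy⟩

lemma integrable_iSup_of_nonneg {S : Type*} [MeasurableSpace S] {ν : Measure S} {f : ι → S → ℝ}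
    (hf0 : ∀ a, ∀ᵐ z ∂ν, 0 ≤ f a z) (hm : Measurable fun z => ⨆ a, f a z)
    (hint : ∀ a, Integrable (f a) ν) : Integrable (fun z => ⨆ a, f a z) ν := by
  cases nonempty_fintype ι
  refine Integrable.mono' (integrable_finsetSum Finset.univ fun a _ => hint a)
    hm.aestronglyMeasurable ?_
  filter_upwards [ae_all_iff.2 hf0] with z hz
  rw [Real.norm_of_nonneg (Real.iSup_nonneg hz),
    iSup_le_iff_of_nonneg (Finset.sum_nonneg fun a _ => hz a)]
  exact fun a => Finset.single_le_sum (f := fun a => f a z) (fun a _ => hz a) (Finset.mem_univ a)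

lemma measurableSet_forall_le (τ : ι → Param p) (c : ι → Fin d) (x : ι → ℝ) :
    MeasurableSet {f : PathSpace p d | ∀ a, f (τ a) (c a) ≤ x a} := by
  rw [ofPred_forall]
  refine MeasurableSet.iInter fun a => measurableSet_le ?_ measurable_const
  exact (measurable_pi_apply (c a)).comp (measurable_pi_apply (τ a))

theorem deHaanLaw_forall_le (ν : Measure (PathSpace p d)) [IsProbabilityMeasure ν]
    (hν0 : ∀ t i, ∀ᵐ z ∂ν, 0 ≤ z t i) (hint : ∀ t i, Integrable (fun z => z t i) ν)
    (τ : ι → Param p) (c : ι → Fin d) {x : ι → ℝ} (hx : ∀ a, 0 < x a) :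
    deHaanLaw 1 ν {f | ∀ a, f (τ a) (c a) ≤ x a} =
      ENNReal.ofReal (Real.exp (-∫ z, ⨆ a, z (τ a) (c a) / x a ∂ν)) := by
  have hm : ∀ t i, Measurable fun z : PathSpace p d => z t i := fun t i =>
    (measurable_pi_apply i).comp (measurable_pi_apply t)
  have hφ0 : ∀ a, ∀ᵐ z ∂ν, 0 ≤ z (τ a) (c a) / x a := fun a => by
    filter_upwards [hν0 (τ a) (c a)] with z hz using div_nonneg hz (hx a).le
  rw [← markedLaw_forall_le ν (measurable_iSup_div τ c x)
    (by filter_upwards [ae_all_iff.2 hφ0] with z hz using Real.iSup_nonneg hz)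
    (integrable_iSup_of_nonneg hφ0 (measurable_iSup_div τ c x) fun a => (hint _ _).div_const _),
    deHaanLaw, Measure.map_apply (measurable_deHaanMax 1) (measurableSet_forall_le τ c x)]
  refine measure_congr ?_
  -- An unbounded real supremum takes the default value 0, so the maximum is at most `x a` exactly
  -- when all its terms are only once boundedness is known.
  have hbd := ae_all_iff.2 fun a => ae_exists_forall_le_mul_arrival ν (hm (τ a) (c a))
    (hν0 (τ a) (c a)) (hint (τ a) (c a))
  filter_upwards [hbd, ae_pos_markedLaw ν] with w hw hpos
  have harr : ∀ k, 0 < arrival w.1 k := fun k =>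
    Finset.sum_pos (fun j _ => hpos j) ⟨0, by simp⟩
  have hpow : ∀ k, arrival w.1 k ^ (-1 / 1 : ℝ) = (arrival w.1 k)⁻¹ := fun k => by
    rw [div_one, Real.rpow_neg_one]
  refine propext ?_
  change (∀ a, deHaanMax 1 w (τ a) (c a) ≤ x a) ↔
    ∀ k, ⨆ a, w.2 k (τ a) (c a) / x a ≤ arrival w.1 k
  simp only [deHaanMax, hpow]
  have h1 : ∀ a, (⨆ k, (arrival w.1 k)⁻¹ * w.2 k (τ a) (c a)) ≤ x a ↔
      ∀ k, (arrival w.1 k)⁻¹ * w.2 k (τ a) (c a) ≤ x a := by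
    intro a
    refine ciSup_le_iff ?_
    obtain ⟨b, hb⟩ := hw a
    refine ⟨b, ?_⟩
    rintro _ ⟨k, rfl⟩
    rw [inv_mul_le_iff₀ (harr k), mul_comm]
    exact hb k
  simp only [h1, iSup_le_iff_of_nonneg (harr _).le]
  rw [forall_comm]
  refine forall₂_congr fun k a => ?_
  rw [inv_mul_le_iff₀ (harr k), div_le_iff₀ (hx a)]

end MaxFunctional

/-! ### Exponential change of measure for Gaussian vectors. -/

section Gaussian

variable {Ω : Type*} [MeasurableSpace Ω] {Q : Measure Ω}

lemma mgf_of_centered {S : Ω → ℝ} (hS : HasGaussianLaw S Q) (h0 : ∫ ω, S ω ∂Q = 0) (t : ℝ) :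
    mgf S Q t = Real.exp (Var[S; Q] * t ^ 2 / 2) := by
  rw [mgf_gaussianReal hS.map_eq_gaussianReal, h0, Real.coe_toNNReal _ (variance_nonneg _ _)]
  simp

lemma integrable_exp_of_hasGaussianLaw {S : Ω → ℝ} (hS : HasGaussianLaw S Q) :
    Integrable (fun ω => Real.exp (S ω)) Q := by
  have h := integrable_exp_mul_gaussianReal (μ := ∫ ω, S ω ∂Q) (v := Var[S; Q].toNNReal) 1
  rw [← hS.map_eq_gaussianReal, integrable_map_measure (by fun_prop) hS.aemeasurable] at h
  simpa using! h

lemma integral_exp_of_centered {S : Ω → ℝ} (hS : HasGaussianLaw S Q) (h0 : ∫ ω, S ω ∂Q = 0) :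
    ∫ ω, Real.exp (S ω) ∂Q = Real.exp (Var[S; Q] / 2) := by
  simpa [mgf] using! mgf_of_centered hS h0 1

/-- Positivity of `mgf` encodes finiteness, its default value being 0. Finite everywhere, it extends
analytically to the complex plane, and the extension determines the law. -/
lemma map_eq_of_mgf_eq {Ω' : Type*} [MeasurableSpace Ω'] {Q' : Measure Ω'} [IsProbabilityMeasure Q]
    [IsProbabilityMeasure Q'] {S : Ω → ℝ} {S' : Ω' → ℝ} (hS : AEMeasurable S Q)
    (hS' : AEMeasurable S' Q') (h : mgf S Q = mgf S' Q') (hpos : ∀ t, 0 < mgf S Q t) :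
    Q.map S = Q'.map S' := by
  have hset : integrableExpSet S Q = univ :=
    eq_univ_of_forall fun t => mgf_pos_iff.1 (hpos t)
  refine Measure.ext_of_complexMGF_eq hS hS' (funext fun z => ?_)
  refine eqOn_complexMGF_of_mgf h ?_
  simp [hset]

/-- The Cameron–Martin formula for linear functionals of a Gaussian vector. -/
lemma map_tilted_of_hasGaussianLaw [IsProbabilityMeasure Q] {S R : Ω → ℝ}
    (hSR : HasGaussianLaw (fun ω => (S ω, R ω)) Q)
    (hS0 : ∫ ω, S ω ∂Q = 0) (hR0 : ∫ ω, R ω ∂Q = 0) :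
    (Q.tilted R).map S = Q.map fun ω => S ω + cov[S, R; Q] := by
  have hS := hSR.fst
  have hR := hSR.snd
  have hRi := integrable_exp_of_hasGaussianLaw hR
  have hp : IsProbabilityMeasure (Q.tilted R) := isProbabilityMeasure_tilted hRi
  -- The tilted moment generating function is a ratio of two Gaussian ones; the cross term of
  -- `Var(tS + R)` produces the shift by the covariance.
  have hval : ∀ t, mgf S (Q.tilted R) t =
      Real.exp (t * cov[S, R; Q]) * Real.exp (Var[S; Q] * t ^ 2 / 2) := by
    intro t
    have hG : HasGaussianLaw (fun ω => t * S ω + R ω) Q :=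
      hSR.map_fun (t • ContinuousLinearMap.fst ℝ ℝ ℝ + ContinuousLinearMap.snd ℝ ℝ ℝ)
    have hG0 : ∫ ω, (t * S ω + R ω) ∂Q = 0 := by
      rw [integral_add (hS.integrable.const_mul t) hR.integrable, integral_const_mul, hS0, hR0]
      simp
    have h1 : mgf S (Q.tilted R) t =
        (∫ ω, Real.exp (t * S ω + R ω) ∂Q) / ∫ ω, Real.exp (R ω) ∂Q := by
      rw [mgf, integral_tilted, ← integral_div]
      refine integral_congr_ae (Eventually.of_forall fun ω => ?_)
      simp only [smul_eq_mul, Real.exp_add]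
      ring
    have hvar : Var[fun ω => t * S ω + R ω; Q] =
        t ^ 2 * Var[S; Q] + 2 * (t * cov[S, R; Q]) + Var[R; Q] := by
      rw [variance_fun_add (hS.memLp_two.const_mul t) hR.memLp_two, variance_const_mul,
        covariance_const_mul_left]
    rw [h1, integral_exp_of_centered hG hG0, integral_exp_of_centered hR hR0, hvar,
      ← Real.exp_sub, ← Real.exp_add]
    congr 1
    ring
  refine map_eq_of_mgf_eq ?_ (by fun_prop) (funext fun t => ?_) fun t => ?_
  · exact hS.aemeasurable.mono_ac (tilted_absolutelyContinuous _ _)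
  · rw [hval, mgf_add_const, mgf_of_centered hS hS0, mul_comm]
  · rw [hval]
    positivity

variable {ι : Type*} [Fintype ι]

lemma exists_dual_eq_sum (L : StrongDual ℝ (ι → ℝ)) :
    ∃ u : ι → ℝ, ∀ y, L y = ∑ b, u b * y b := by
  classical
  refine ⟨fun b => L (Pi.single b 1), fun y => ?_⟩
  conv_lhs => rw [← Finset.univ_sum_single y, map_sum]
  refine Finset.sum_congr rfl fun b _ => ?_
  have : Pi.single b (y b) = y b • (Pi.single b 1 : ι → ℝ) := by
    rw [← Pi.single_smul]; simp
  rw [this, map_smul, smul_eq_mul, mul_comm]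

lemma integral_dual_eq_zero {X : ι → Ω → ℝ} (hX : ∀ a, Integrable (X a) Q)
    (h0 : ∀ a, ∫ ω, X a ω ∂Q = 0) (L : StrongDual ℝ (ι → ℝ)) :
    ∫ ω, L (fun a => X a ω) ∂Q = 0 := by
  obtain ⟨u, hu⟩ := exists_dual_eq_sum L
  simp_rw [hu]
  rw [integral_finsetSum _ fun b _ => (hX b).const_mul _]
  simp [integral_const_mul, h0]

/-- The Cameron–Martin formula for a centered Gaussian vector, in the direction of one of its
components. -/
theorem integral_exp_mul_of_hasGaussianLaw [IsProbabilityMeasure Q] {X : ι → Ω → ℝ}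
    (hX : HasGaussianLaw (fun ω a => X a ω) Q) (h0 : ∀ a, ∫ ω, X a ω ∂Q = 0) (a : ι)
    {f : (ι → ℝ) → ℝ} (hf : Measurable f) :
    ∫ ω, Real.exp (X a ω - Var[X a; Q] / 2) * f (fun b => X b ω) ∂Q =
      ∫ ω, f (fun b => X b ω + cov[X b, X a; Q]) ∂Q := by
  have hXa : ∀ b, HasGaussianLaw (X b) Q := fun b => hX.eval b
  have hRi := integrable_exp_of_hasGaussianLaw (hXa a)
  have hp : IsProbabilityMeasure (Q.tilted (X a)) := isProbabilityMeasure_tilted hRi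
  have hXm : AEMeasurable (fun ω b => X b ω) (Q.tilted (X a)) :=
    hX.aemeasurable.mono_ac (tilted_absolutelyContinuous _ _)
  have hXm2 : AEMeasurable (fun ω b => X b ω + cov[X b, X a; Q]) Q :=
    aemeasurable_pi_lambda _ fun b => (hXa b).aemeasurable.add_const _
  have hlaw : (Q.tilted (X a)).map (fun ω b => X b ω) =
      Q.map fun ω b => X b ω + cov[X b, X a; Q] := by
    have := Measure.isProbabilityMeasure_map (μ := Q.tilted (X a)) hXm
    have := Measure.isProbabilityMeasure_map (μ := Q) hXm2
    -- Cramér–Wold: it suffices to treat each linear functional `L` of the vector, to which the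
    -- scalar formula applies with `R = Xₐ`.
    refine Measure.ext_of_charFunDual (funext fun L => ?_)
    rw [charFunDual_eq_charFun_map_one, charFunDual_eq_charFun_map_one,
      AEMeasurable.map_map_of_aemeasurable (by fun_prop) hXm,
      AEMeasurable.map_map_of_aemeasurable (by fun_prop) hXm2]
    have hLG : HasGaussianLaw (fun ω => (L fun b => X b ω, X a ω)) Q :=
      hX.map_fun (L.prod (ContinuousLinearMap.proj a))
    have h1 := map_tilted_of_hasGaussianLaw hLG
      (integral_dual_eq_zero (fun b => (hXa b).integrable) h0 L) (h0 a)
    have h2 : cov[fun ω => L fun b => X b ω, X a; Q] = L fun b => cov[X b, X a; Q] := by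
      obtain ⟨u, hu⟩ := exists_dual_eq_sum L
      simp_rw [hu]
      rw [covariance_fun_sum_left (fun b => (hXa b).memLp_two.const_mul _) (hXa a).memLp_two]
      simp_rw [covariance_const_mul_left]
    rw [h2] at h1
    congr 1
    refine h1.trans ?_
    congr 1
    ext ω
    exact (map_add L _ _).symm
  rw [← integral_map hXm2 hf.aestronglyMeasurable, ← hlaw,
    integral_map hXm hf.aestronglyMeasurable, integral_tilted,
    integral_exp_of_centered (hXa a) (h0 a)]
  simp [Real.exp_sub]

/-- Polarization expresses the covariances of the increments from `Xₐ` through variances of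
differences alone. -/
lemma charFunDual_map_sub [IsProbabilityMeasure Q] {X : ι → Ω → ℝ}
    (hX : HasGaussianLaw (fun ω a => X a ω) Q) (h0 : ∀ a, ∫ ω, X a ω ∂Q = 0) (a : ι)
    {L : StrongDual ℝ (ι → ℝ)} {u : ι → ℝ} (hu : ∀ y, L y = ∑ b, u b * y b) :
    charFunDual (Q.map fun ω b => X b ω - X a ω) L =
      Complex.exp (-((∑ b, ∑ c, u b * (u c *
        ((Var[fun ω => X b ω - X a ω; Q] + Var[fun ω => X c ω - X a ω; Q] -
          Var[fun ω => X b ω - X c ω; Q]) / 2)) : ℝ) : ℂ) / 2) := by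
  have hDb : ∀ b, HasGaussianLaw (fun ω => X b ω - X a ω) Q := fun b =>
    (hX.prodMk b a).fun_sub
  let D : (ι → ℝ) →L[ℝ] (ι → ℝ) := ContinuousLinearMap.pi fun b : ι =>
    ContinuousLinearMap.proj (R := ℝ) (φ := fun _ : ι => ℝ) b -
      ContinuousLinearMap.proj (R := ℝ) (φ := fun _ : ι => ℝ) a
  have hD : HasGaussianLaw (fun ω b => X b ω - X a ω) Q := hX.map_fun D
  have hi : ∀ b, Integrable (X b) Q := fun b => (hX.eval b).integrable
  have hcov : ∀ b c, cov[fun ω => X b ω - X a ω, fun ω => X c ω - X a ω; Q] =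
      (Var[fun ω => X b ω - X a ω; Q] + Var[fun ω => X c ω - X a ω; Q] -
          Var[fun ω => X b ω - X c ω; Q]) / 2 := by
    intro b c
    have h1 := variance_fun_sub (hDb b).memLp_two (hDb c).memLp_two
    simp only [sub_sub_sub_cancel_right] at h1
    rw [h1]
    ring
  have hv : Var[fun ω => L fun b => X b ω - X a ω; Q] =
      ∑ b, ∑ c, u b * (u c *
        ((Var[fun ω => X b ω - X a ω; Q] + Var[fun ω => X c ω - X a ω; Q] -
          Var[fun ω => X b ω - X c ω; Q]) / 2)) := by
    simp_rw [hu]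
    rw [variance_fun_sum fun b => (hDb b).memLp_two.const_mul _]
    simp_rw [covariance_const_mul_left, covariance_const_mul_right, hcov]
  rw [hD.charFunDual_map_eq_fun, integral_dual_eq_zero (fun b => (hDb b).integrable)
    (fun b => by rw [integral_sub (hi b) (hi a), h0, h0, sub_zero]), hv]
  congr 1
  push_cast
  ring

/-- The law of the increments of a centered Gaussian vector is determined by their variances. -/
theorem map_sub_eq_of_variance_sub_eq {Ω' : Type*} [MeasurableSpace Ω'] {Q' : Measure Ω'}
    [IsProbabilityMeasure Q] [IsProbabilityMeasure Q'] {X : ι → Ω → ℝ} {X' : ι → Ω' → ℝ}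
    (hX : HasGaussianLaw (fun ω a => X a ω) Q) (h0 : ∀ a, ∫ ω, X a ω ∂Q = 0)
    (hX' : HasGaussianLaw (fun ω a => X' a ω) Q') (h0' : ∀ a, ∫ ω, X' a ω ∂Q' = 0)
    (hvar : ∀ a b, Var[fun ω => X a ω - X b ω; Q] = Var[fun ω => X' a ω - X' b ω; Q']) (a : ι) :
    Q.map (fun ω b => X b ω - X a ω) = Q'.map (fun ω b => X' b ω - X' a ω) := by
  have h1 : AEMeasurable (fun ω b => X b ω - X a ω) Q := aemeasurable_pi_lambda _ fun b =>
    (hX.eval b).aemeasurable.sub (hX.eval a).aemeasurable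
  have h2 : AEMeasurable (fun ω b => X' b ω - X' a ω) Q' := aemeasurable_pi_lambda _ fun b =>
    (hX'.eval b).aemeasurable.sub (hX'.eval a).aemeasurable
  have := Measure.isProbabilityMeasure_map h1
  have := Measure.isProbabilityMeasure_map h2
  refine Measure.ext_of_charFunDual (funext fun L => ?_)
  obtain ⟨u, hu⟩ := exists_dual_eq_sum L
  rw [charFunDual_map_sub hX h0 a hu, charFunDual_map_sub hX' h0' a hu]
  simp_rw [hvar]

end Gaussian

/-! ### The exponent `E maxₐ exp(Xₐ - Var(Xₐ)/2)/xₐ`. -/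

section Exponent

variable {Ω : Type*} [MeasurableSpace Ω] {Q : Measure Ω} [IsProbabilityMeasure Q]
  {ι : Type*} [Fintype ι]

lemma variance_sub_eq {S R : Ω → ℝ} (hS : MemLp S 2 Q) (hR : MemLp R 2 Q) :
    Var[fun ω => S ω - R ω; Q] = Var[S; Q] - 2 * cov[S, R; Q] + Var[R; Q] :=
  variance_fun_sub hS hR

/-- Once `exp(Xₐ - Var(Xₐ)/2)` is pulled out of the supremum, the Cameron–Martin shift combines with
the remaining constants into half the variance of `X_b - Xₐ`. -/
lemma integral_iSup_exp_eq {X : ι → Ω → ℝ}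
    (hX : HasGaussianLaw (fun ω a => X a ω) Q) (h0 : ∀ a, ∫ ω, X a ω ∂Q = 0) (x : ι → ℝ) (a : ι) :
    ∫ ω, ⨆ b, Real.exp (X b ω - Var[X b; Q] / 2) / x b ∂Q =
      ∫ ω, ⨆ b, Real.exp (X b ω - X a ω - Var[fun ω => X b ω - X a ω; Q] / 2) / x b ∂Q := by
  have hXa : ∀ b, HasGaussianLaw (X b) Q := fun b => hX.eval b
  have : Nonempty ι := ⟨a⟩
  have h1 := integral_exp_mul_of_hasGaussianLaw hX h0 a
    (f := fun y => ⨆ b, Real.exp (y b - y a - (Var[X b; Q] - Var[X a; Q]) / 2) / x b)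
    (Measurable.iSup fun b => by fun_prop)
  refine (integral_congr_ae (Eventually.of_forall fun ω => ?_)).trans
    (h1.trans (integral_congr_ae (Eventually.of_forall fun ω => ?_)))
  · simp only
    rw [Real.mul_iSup_of_nonneg (Real.exp_pos _).le]
    refine iSup_congr fun b => ?_
    rw [mul_div_assoc', ← Real.exp_add]
    congr 2
    ring
  · refine iSup_congr fun b => ?_
    beta_reduce
    rw [variance_sub_eq (hXa b).memLp_two (hXa a).memLp_two, covariance_self (hXa a).aemeasurable]
    congr 2
    ring

theorem integral_iSup_exp_eq_of_variance_sub_eq {Ω' : Type*} [MeasurableSpace Ω']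
    {Q' : Measure Ω'} [IsProbabilityMeasure Q'] {X : ι → Ω → ℝ} {X' : ι → Ω' → ℝ}
    (hX : HasGaussianLaw (fun ω a => X a ω) Q) (h0 : ∀ a, ∫ ω, X a ω ∂Q = 0)
    (hX' : HasGaussianLaw (fun ω a => X' a ω) Q') (h0' : ∀ a, ∫ ω, X' a ω ∂Q' = 0)
    (hvar : ∀ a b, Var[fun ω => X a ω - X b ω; Q] = Var[fun ω => X' a ω - X' b ω; Q'])
    (x : ι → ℝ) :
    ∫ ω, ⨆ b, Real.exp (X b ω - Var[X b; Q] / 2) / x b ∂Q =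
      ∫ ω, ⨆ b, Real.exp (X' b ω - Var[X' b; Q'] / 2) / x b ∂Q' := by
  rcases isEmpty_or_nonempty ι with hι | ⟨⟨a⟩⟩
  · simp
  rw [integral_iSup_exp_eq hX h0 x a, integral_iSup_exp_eq hX' h0' x a]
  have h1 : AEMeasurable (fun ω b => X b ω - X a ω) Q := aemeasurable_pi_lambda _ fun b =>
    (hX.eval b).aemeasurable.sub (hX.eval a).aemeasurable
  have h2 : AEMeasurable (fun ω b => X' b ω - X' a ω) Q' := aemeasurable_pi_lambda _ fun b =>
    (hX'.eval b).aemeasurable.sub (hX'.eval a).aemeasurable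
  have hf : Measurable fun y : ι → ℝ =>
      ⨆ b, Real.exp (y b - Var[fun ω => X b ω - X a ω; Q] / 2) / x b :=
    Measurable.iSup fun b => by fun_prop
  have h3 := integral_map h1 hf.aestronglyMeasurable
  have h4 := integral_map h2 hf.aestronglyMeasurable
  rw [map_sub_eq_of_variance_sub_eq hX h0 hX' h0' hvar a, h4] at h3
  simp_rw [← hvar]
  exact h3.symm

lemma iSup_eq_sum_of_injective {f : ι → ℝ} (hf : Function.Injective f) :
    ⨆ a, f a = ∑ a, f a * {y : ι → ℝ | ∀ b, b ≠ a → y b ≤ y a}.indicator 1 f := by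
  rcases isEmpty_or_nonempty ι with hι | hι
  · simp
  obtain ⟨a, ha⟩ := Finite.exists_max f
  rw [Finset.sum_eq_single a]
  · rw [indicator_of_mem (by intro b _; exact ha b)]
    simpa using le_antisymm (ciSup_le ha) (le_ciSup (Set.finite_range f).bddAbove a)
  · intro b _ hb
    rw [indicator_of_notMem, mul_zero]
    intro h
    exact hb (hf (le_antisymm (ha b) (h a hb.symm)))
  · simp

/-- Without ties exactly one index attains the maximum. The Cameron–Martin formula in direction `Xₐ`
turns the contribution of `a` into `1/xₐ` times the probability of the shifted event that `a` is the
maximizer. -/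
theorem integral_iSup_exp_eq_sum {X : ι → Ω → ℝ} (hXm : ∀ a, Measurable (X a))
    (hX : HasGaussianLaw (fun ω a => X a ω) Q) (h0 : ∀ a, ∫ ω, X a ω ∂Q = 0)
    (hties : ∀ a b, a ≠ b → ∀ r, ∀ᵐ ω ∂Q, X a ω - X b ω ≠ r) {x : ι → ℝ} (hx : ∀ a, 0 < x a) :
    ∫ ω, ⨆ b, Real.exp (X b ω - Var[X b; Q] / 2) / x b ∂Q =
      ∑ a, 1 / x a * Q.real {ω | ∀ b, b ≠ a →
        X b ω - X a ω - Var[fun ω => X b ω - X a ω; Q] / 2 ≤ Real.log (x b / x a)} := by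
  classical
  have hXa : ∀ b, HasGaussianLaw (X b) Q := fun b => hX.eval b
  let g : ι → ℝ → ℝ := fun b y => Real.exp (y - Var[X b; Q] / 2) / x b
  have hg : ∀ b y, g b y = Real.exp (y - Var[X b; Q] / 2 - Real.log (x b)) := fun b y => by
    rw [Real.exp_sub _ (Real.log _), Real.exp_log (hx b)]
  let B : ι → Set (ι → ℝ) := fun a => {y | ∀ b, b ≠ a → g b (y b) ≤ g a (y a)}
  have hB : ∀ a, MeasurableSet (B a) := by
    intro a
    have h1 : B a = ⋂ b, ⋂ (_ : b ≠ a), {y | g b (y b) ≤ g a (y a)} := by ext; simp [B]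
    rw [h1]
    refine MeasurableSet.iInter fun b => MeasurableSet.iInter fun _ => ?_
    exact measurableSet_le (by fun_prop) (by fun_prop)
  have hBi : ∀ a, Measurable ((B a).indicator (1 : (ι → ℝ) → ℝ)) := fun a =>
    measurable_one.indicator (hB a)
  have hXv : Measurable fun ω a => X a ω := measurable_pi_lambda _ hXm
  -- Two weighted exponentials coincide only if `X a - X b` equals one specific constant.
  have hinj : ∀ᵐ ω ∂Q, Function.Injective fun b => g b (X b ω) := by
    have h1 : ∀ᵐ ω ∂Q, ∀ a b, a ≠ b → X a ω - X b ω ≠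
        Var[X a; Q] / 2 + Real.log (x a) - (Var[X b; Q] / 2 + Real.log (x b)) := by
      rw [ae_all_iff]
      intro a
      rw [ae_all_iff]
      intro b
      by_cases hab : a = b
      · simp [hab]
      · filter_upwards [hties a b hab _] with ω hω _ using hω
    filter_upwards [h1] with ω hω a b hab
    by_contra hne
    simp only [hg, Real.exp_eq_exp] at hab
    exact hω a b hne (by linarith)
  have hterm : ∀ a, Integrable (fun ω => g a (X a ω) * (B a).indicator 1 (fun b => X b ω)) Q := by
    intro a
    have h1 : Integrable (fun ω => g a (X a ω)) Q := by
      simp only [g, Real.exp_sub]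
      exact ((integrable_exp_of_hasGaussianLaw (hXa a)).div_const _).div_const _
    refine h1.mul_bdd (c := 1) ((hBi a).comp hXv).aestronglyMeasurable
      (Eventually.of_forall fun ω => ?_)
    rw [indicator_apply]
    split_ifs <;> simp
  have hval : ∀ a, ∫ ω, g a (X a ω) * (B a).indicator 1 (fun b => X b ω) ∂Q =
      1 / x a * Q.real {ω | ∀ b, b ≠ a →
        X b ω - X a ω - Var[fun ω => X b ω - X a ω; Q] / 2 ≤ Real.log (x b / x a)} := by
    intro a
    have h1 := integral_exp_mul_of_hasGaussianLaw hX h0 a (hBi a)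
    have h2 : (fun ω b => X b ω + cov[X b, X a; Q]) ⁻¹' (B a) = {ω | ∀ b, b ≠ a →
        X b ω - X a ω - Var[fun ω => X b ω - X a ω; Q] / 2 ≤ Real.log (x b / x a)} := by
      ext ω
      refine forall₂_congr fun b hb => ?_
      beta_reduce
      rw [hg, hg, Real.exp_le_exp, Real.log_div (hx b).ne' (hx a).ne',
        variance_sub_eq (hXa b).memLp_two (hXa a).memLp_two, covariance_self (hXa a).aemeasurable]
      constructor <;> intro h <;> linarith
    have h3 : Measurable fun ω b => X b ω + cov[X b, X a; Q] :=
      measurable_pi_lambda _ fun b => (hXm b).add_const _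
    have h4 : ∫ ω, (B a).indicator (1 : (ι → ℝ) → ℝ) (fun b => X b ω + cov[X b, X a; Q]) ∂Q =
        Q.real {ω | ∀ b, b ≠ a →
        X b ω - X a ω - Var[fun ω => X b ω - X a ω; Q] / 2 ≤ Real.log (x b / x a)} := by
      rw [← h2, ← integral_indicator_one (h3 (hB a))]
      rfl
    rw [← h4, ← h1, ← integral_const_mul]
    refine integral_congr_ae (Eventually.of_forall fun ω => ?_)
    simp only [g]
    ring
  calc ∫ ω, ⨆ b, Real.exp (X b ω - Var[X b; Q] / 2) / x b ∂Q
      = ∫ ω, ∑ a, g a (X a ω) * (B a).indicator 1 (fun b => X b ω) ∂Q := by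
        refine integral_congr_ae ?_
        filter_upwards [hinj] with ω hω
        exact iSup_eq_sum_of_injective hω
    _ = _ := by
        rw [integral_finsetSum _ fun a _ => hterm a]
        exact Finset.sum_congr rfl fun a _ => hval a

end Exponent

/-! ### Laws on path space and their joint distribution functions. -/

lemma measurable_eval_pathSpace (t : Param p) (i : Fin d) :
    Measurable fun f : PathSpace p d => f t i :=
  (measurable_pi_apply i).comp (measurable_pi_apply t)

/-- Two laws of nonnegative processes agree if their joint distribution functions agree at all
points with positive coordinates. -/
theorem pathSpace_measure_ext {μ μ' : Measure (PathSpace p d)} [IsProbabilityMeasure μ]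
    [IsProbabilityMeasure μ'] (hμ : ∀ t i, ∀ᵐ f ∂μ, 0 ≤ f t i) (hμ' : ∀ t i, ∀ᵐ f ∂μ', 0 ≤ f t i)
    (h : ∀ (S : Finset (Param p × Fin d)) (x : S → ℝ), (∀ a, 0 < x a) →
      μ {f | ∀ a : S, f a.1.1 a.1.2 ≤ x a} = μ' {f | ∀ a : S, f a.1.1 a.1.2 ≤ x a}) :
    μ = μ' := by
  let π : Param p × Fin d → Set (Set (PathSpace p d)) := fun a =>
    range fun r : ℝ => {f | f a.1 a.2 ≤ r}
  have hmeas : ∀ (a : Param p × Fin d) (r : ℝ), MeasurableSet {f : PathSpace p d | f a.1 a.2 ≤ r} :=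
    fun a r => measurableSet_le (measurable_eval_pathSpace _ _) measurable_const
  have hgen : (MeasurableSpace.pi : MeasurableSpace (PathSpace p d)) =
      MeasurableSpace.generateFrom (piiUnionInter π univ) := by
    refine le_antisymm ?_ ?_
    · have hid : @Measurable _ _ (MeasurableSpace.generateFrom (piiUnionInter π univ))
          MeasurableSpace.pi (id : PathSpace p d → PathSpace p d) := by
        refine @measurable_pi_lambda _ _ _ (MeasurableSpace.generateFrom (piiUnionInter π univ))
          _ _ fun t => ?_
        refine @measurable_pi_lambda _ _ _ (MeasurableSpace.generateFrom (piiUnionInter π univ))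
          _ _ fun i => ?_
        refine @measurable_of_Iic _ _ _ _ _
          (MeasurableSpace.generateFrom (piiUnionInter π univ)) _ _ _ _ fun r => ?_
        exact MeasurableSpace.measurableSet_generateFrom
          (subset_piiUnionInter (mem_univ (t, i)) ⟨r, rfl⟩)
      intro s hs
      exact hid hs
    · refine generateFrom_piiUnionInter_le π (fun a => MeasurableSpace.generateFrom_le ?_) univ
      rintro _ ⟨r, rfl⟩
      exact hmeas a r
  have hpi : IsPiSystem (piiUnionInter π univ) := by
    refine isPiSystem_piiUnionInter π (fun a => ?_) univ
    rintro _ ⟨r, rfl⟩ _ ⟨s, rfl⟩ -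
    exact ⟨min r s, by ext f; simp⟩
  refine ext_of_generate_finite _ hgen hpi ?_ (by simp)
  rintro s ⟨S, -, f, hf, rfl⟩
  choose! r hr using hf
  have hset : (⋂ a ∈ S, f a) = {g : PathSpace p d | ∀ a : S, g a.1.1 a.1.2 ≤ r a} := by
    ext g
    simp only [mem_iInter, mem_ofPred_eq, Subtype.forall]
    refine forall₂_congr fun a ha => ?_
    rw [← hr a ha]
    rfl
  rw [hset]
  -- The hypothesis covers positive levels only. A negative level gives a null event on both sides;
  -- levels equal to 0 are approached from above by `r a + 1/(n + 1)`.
  by_cases hneg : ∃ a : S, r a < 0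
  · obtain ⟨a, ha⟩ := hneg
    have hzero : ∀ {ρ : Measure (PathSpace p d)}, (∀ t i, ∀ᵐ f ∂ρ, 0 ≤ f t i) →
        ρ {g : PathSpace p d | ∀ a : S, g a.1.1 a.1.2 ≤ r a} = 0 := by
      intro ρ hρ
      refine measure_mono_null ?_ (ae_iff.1 (hρ a.1.1 a.1.2))
      intro g hg
      exact not_le.2 ((hg a).trans_lt ha)
    rw [hzero hμ, hzero hμ']
  · have hr0 : ∀ a : S, 0 ≤ r a := by simpa using hneg
    have hlim : ∀ (ρ : Measure (PathSpace p d)) [IsProbabilityMeasure ρ], Tendsto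
        (fun n : ℕ => ρ {g : PathSpace p d | ∀ a : S, g a.1.1 a.1.2 ≤ r a + 1 / ((n : ℝ) + 1)})
        atTop (𝓝 (ρ {g : PathSpace p d | ∀ a : S, g a.1.1 a.1.2 ≤ r a})) := by
      intro ρ _
      have hinter : {g : PathSpace p d | ∀ a : S, g a.1.1 a.1.2 ≤ r a} =
          ⋂ n : ℕ, {g : PathSpace p d | ∀ a : S, g a.1.1 a.1.2 ≤ r a + 1 / ((n : ℝ) + 1)} := by
        ext g
        simp only [mem_ofPred_eq, mem_iInter]
        refine ⟨fun hg n a => (hg a).trans (le_add_of_nonneg_right (by positivity)),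
          fun hg a => ?_⟩
        have h1 := (tendsto_one_div_add_atTop_nhds_zero_nat (𝕜 := ℝ)).const_add (r a)
        rw [add_zero] at h1
        exact ge_of_tendsto' h1 fun n => hg n a
      rw [hinter]
      refine tendsto_measure_iInter_atTop (fun n => ?_) ?_ ⟨0, measure_ne_top _ _⟩
      · exact (measurableSet_forall_le (fun a : S => a.1.1) (fun a => a.1.2) _).nullMeasurableSet
      · intro m n hmn g hg a
        refine (hg a).trans ?_
        gcongr
    refine tendsto_nhds_unique (hlim μ) ((hlim μ').congr fun n => ?_)
    exact (h S _ fun a => add_pos_of_nonneg_of_pos (hr0 a) (by positivity)).symm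

/-! ### Finite-dimensional distributions of Brown–Resnick processes. -/

section BrownResnickProcess

variable {Ω Ω' : Type*} [MeasurableSpace Ω] [MeasurableSpace Ω']

lemma HasPathsInC.measurable_paths {X : Param p → Ω → Fin d → ℝ} (hX : HasPathsInC X) :
    Measurable fun ω t => X t ω :=
  measurable_pi_lambda _ hX.measurable

lemma isProbabilityMeasure_processLaw {X : Param p → Ω → Fin d → ℝ} (hX : HasPathsInC X)
    (P : Measure Ω) [IsProbabilityMeasure P] : IsProbabilityMeasure (processLaw X P) :=
  Measure.isProbabilityMeasure_map hX.measurable_paths.aemeasurable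

lemma ae_nonneg_processLaw {X : Param p → Ω → Fin d → ℝ} (hX : HasPathsInC X) (P : Measure Ω)
    (t : Param p) (i : Fin d) : ∀ᵐ f ∂processLaw X P, 0 ≤ f t i := by
  rw [processLaw, ae_map_iff hX.measurable_paths.aemeasurable
    (measurableSet_le measurable_const (measurable_eval_pathSpace t i))]
  exact Eventually.of_forall fun ω => hX.nonneg t ω i

lemma HasPathsInC.comp_sub {X : Param p → Ω → Fin d → ℝ} (hX : HasPathsInC X) (h : Param p) :
    HasPathsInC fun t => X (t - h) where
  measurable _ := hX.measurable _
  continuous ω := (hX.continuous ω).comp (continuous_id.sub continuous_const)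
  nonneg _ := hX.nonneg _

theorem processLaw_eq_of_forall {X : Param p → Ω → Fin d → ℝ} {X' : Param p → Ω' → Fin d → ℝ}
    {P : Measure Ω} [IsProbabilityMeasure P] {P' : Measure Ω'} [IsProbabilityMeasure P']
    (hX : HasPathsInC X) (hX' : HasPathsInC X')
    (h : ∀ (S : Finset (Param p × Fin d)) (x : S → ℝ), (∀ a, 0 < x a) →
      P {ω | ∀ a : S, X a.1.1 ω a.1.2 ≤ x a} = P' {ω | ∀ a : S, X' a.1.1 ω a.1.2 ≤ x a}) :
    processLaw X P = processLaw X' P' := by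
  have := isProbabilityMeasure_processLaw hX P
  have := isProbabilityMeasure_processLaw hX' P'
  refine pathSpace_measure_ext (ae_nonneg_processLaw hX P) (ae_nonneg_processLaw hX' P')
    fun S x hx => ?_
  have hm := measurableSet_forall_le (fun a : S => a.1.1) (fun a => a.1.2) x
  rw [processLaw, processLaw, Measure.map_apply hX.measurable_paths hm,
    Measure.map_apply hX'.measurable_paths hm]
  exact h S x hx

variable {P : Measure Ω} {Q : Measure Ω'} {X : Param p → Ω → Fin d → ℝ}
  {Y : Param p → Ω' → Fin d → ℝ} {ι : Type*} [Fintype ι]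

lemma hasGaussianLaw_eval_pi (hY : IsGaussianProcess Y Q) (τ : ι → Param p) (c : ι → Fin d) :
    HasGaussianLaw (fun ω a => Y (τ a) ω (c a)) Q := by
  classical
  let L : (Finset.univ.image τ → Fin d → ℝ) →L[ℝ] (ι → ℝ) := ContinuousLinearMap.pi fun a =>
    (ContinuousLinearMap.proj (R := ℝ) (φ := fun _ : Fin d => ℝ) (c a)).comp
      (ContinuousLinearMap.proj (R := ℝ) (φ := fun _ : Finset.univ.image τ => Fin d → ℝ)
        ⟨τ a, by simp⟩)
  exact (hY.hasGaussianLaw (Finset.univ.image τ)).map_fun L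

/-- A Gaussian process is a priori only almost everywhere measurable; genuine measurability is
recovered by taking the logarithm of the spectral process. -/
lemma IsBrownResnick.measurable_gaussian (h : IsBrownResnick X P Y Q) (t : Param p) (i : Fin d) :
    Measurable fun ω => Y t ω i := by
  have h1 := (measurable_pi_apply i).comp (h.maxStable.spectral_paths.measurable t)
  have h2 := (Real.measurable_log.comp h1).add_const (Var[fun ω => Y t ω i; Q] / 2)
  convert! h2 using 2
  simp [logGaussian]

/-- The finite-dimensional distributions of a Brown–Resnick process. -/
theorem IsBrownResnick.measure_forall_le [IsProbabilityMeasure Q] (h : IsBrownResnick X P Y Q)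
    (τ : ι → Param p) (c : ι → Fin d) {x : ι → ℝ} (hx : ∀ a, 0 < x a) :
    P {ω | ∀ a, X (τ a) ω (c a) ≤ x a} = ENNReal.ofReal (Real.exp (-∫ ω, ⨆ a,
      Real.exp (Y (τ a) ω (c a) - Var[fun ω' => Y (τ a) ω' (c a); Q] / 2) / x a ∂Q)) := by
  have hZ := h.maxStable.spectral_paths
  have hν := isProbabilityMeasure_processLaw hZ Q
  have h1 : P {ω | ∀ a, X (τ a) ω (c a) ≤ x a} =
      processLaw X P {f | ∀ a, f (τ a) (c a) ≤ x a} := by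
    rw [processLaw, Measure.map_apply h.maxStable.paths.measurable_paths
      (measurableSet_forall_le τ c x)]
    rfl
  have hint : ∀ t i, Integrable (fun z : PathSpace p d => z t i)
      (processLaw (logGaussian Y Q) Q) := by
    intro t i
    rw [processLaw, integrable_map_measure (measurable_eval_pathSpace t i).aestronglyMeasurable
      hZ.measurable_paths.aemeasurable]
    have hY : HasGaussianLaw (fun ω => Y t ω i) Q :=
      (hasGaussianLaw_eval_pi h.gaussian (fun _ : Unit => t) fun _ => i).eval ()
    have h2 := (integrable_exp_of_hasGaussianLaw hY).div_const
      (Real.exp (Var[fun ω => Y t ω i; Q] / 2))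
    simpa only [← Real.exp_sub] using! h2
  rw [h1, h.maxStable.law_eq,
    deHaanLaw_forall_le _ (ae_nonneg_processLaw hZ Q) hint τ c hx, processLaw,
    integral_map hZ.measurable_paths.aemeasurable
      (measurable_iSup_div τ c x).aestronglyMeasurable]
  rfl

/-- The joint distribution functions of Brown–Resnick processes are determined by the
cross-variograms of the underlying Gaussian processes. -/
theorem measure_forall_le_eq_of_crossVariogram_eq {Ω₁ Ω₁' : Type*} [MeasurableSpace Ω₁]
    [MeasurableSpace Ω₁'] {P₁ : Measure Ω₁} {Q₁ : Measure Ω₁'} [IsProbabilityMeasure Q]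
    [IsProbabilityMeasure Q₁] {X₁ : Param p → Ω₁ → Fin d → ℝ} {Y₁ : Param p → Ω₁' → Fin d → ℝ}
    (h : IsBrownResnick X P Y Q) (h₁ : IsBrownResnick X₁ P₁ Y₁ Q₁) (τ τ₁ : ι → Param p)
    (c : ι → Fin d) {x : ι → ℝ} (hx : ∀ a, 0 < x a)
    (hvar : ∀ a b, crossVariogram Y Q (c a) (c b) (τ a) (τ b) =
      crossVariogram Y₁ Q₁ (c a) (c b) (τ₁ a) (τ₁ b)) :
    P {ω | ∀ a, X (τ a) ω (c a) ≤ x a} = P₁ {ω | ∀ a, X₁ (τ₁ a) ω (c a) ≤ x a} := by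
  rw [h.measure_forall_le τ c hx, h₁.measure_forall_le τ₁ c hx,
    integral_iSup_exp_eq_of_variance_sub_eq
      (X := fun a ω => Y (τ a) ω (c a)) (X' := fun a ω => Y₁ (τ₁ a) ω (c a))
      (hasGaussianLaw_eval_pi h.gaussian τ c) (fun a => h.centered _ _)
      (hasGaussianLaw_eval_pi h₁.gaussian τ₁ c) (fun a => h₁.centered _ _) hvar x]

end BrownResnickProcess

/-! ### Absence of ties under a density. -/

lemma volume_setOf_sub_eq {n : ℕ} {i k : Fin d} {j l : Fin n} (hne : (i, j) ≠ (k, l)) (r : ℝ) :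
    volume {v : Fin n → Fin d → ℝ | v j i - v l k = r} = 0 := by
  have : (volume : Measure (Fin d → ℝ)).IsAddHaarMeasure := Measure.pi.isAddHaarMeasure _
  have : (volume : Measure (Fin n → Fin d → ℝ)).IsAddHaarMeasure :=
    Measure.pi.isAddHaarMeasure fun _ => volume
  let L : (Fin n → Fin d → ℝ) →ₗ[ℝ] ℝ :=
    let ev := fun (i : Fin d) (j : Fin n) =>
      (LinearMap.proj (R := ℝ) (φ := fun _ : Fin d => ℝ) i).comp
        (LinearMap.proj (R := ℝ) (φ := fun _ : Fin n => Fin d → ℝ) j)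
    ev i j - ev k l
  -- A vector with `L e = 1`: it shows that `ker L` is proper, and the level set is `ker L`
  -- translated by `r • e`.
  let e : Fin n → Fin d → ℝ := Pi.single j (Pi.single i 1)
  have hLe : L e = 1 := by
    have h1 : e l k = 0 := by
      by_cases hl : l = j
      · subst hl
        have hk : k ≠ i := fun hk => hne (by rw [hk])
        simp [e, hk]
      · simp [e, hl]
    have h2 : e j i = 1 := by simp [e]
    change e j i - e l k = 1
    rw [h1, h2, sub_zero]
  have hker : LinearMap.ker L ≠ ⊤ := by
    intro htop
    have : e ∈ LinearMap.ker L := htop ▸ Submodule.mem_top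
    rw [LinearMap.mem_ker, hLe] at this
    exact one_ne_zero this
  have hset : {v : Fin n → Fin d → ℝ | v j i - v l k = r} =
      (fun v => v + -(r • e)) ⁻¹' (LinearMap.ker L : Set (Fin n → Fin d → ℝ)) := by
    ext v
    have : L v = v j i - v l k := rfl
    simp [LinearMap.mem_ker, hLe, ← this, ← sub_eq_add_neg, sub_eq_zero]
  rw [hset, measure_preimage_add_right]
  exact Measure.addHaar_submodule _ _ hker

end BrownResnick

end

/-! ### The three assertions. -/

theorem mainTheorem3 {p d : ℕ} {Ω Ω' : Type*} [MeasurableSpace Ω] [MeasurableSpace Ω']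
    (P : Measure Ω) [IsProbabilityMeasure P] (Q : Measure Ω') [IsProbabilityMeasure Q]
    (X : BrownResnick.Param p → Ω → Fin d → ℝ) (Y : BrownResnick.Param p → Ω' → Fin d → ℝ)
    (hX : BrownResnick.IsBrownResnick X P Y Q) :
    -- the law of `X` depends only on the cross-variograms
    (∀ {Ω₁ Ω₁' : Type*} [MeasurableSpace Ω₁] [MeasurableSpace Ω₁']
      (P₁ : Measure Ω₁) [IsProbabilityMeasure P₁] (Q₁ : Measure Ω₁') [IsProbabilityMeasure Q₁]
      (X₁ : BrownResnick.Param p → Ω₁ → Fin d → ℝ) (Y₁ : BrownResnick.Param p → Ω₁' → Fin d → ℝ),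
      BrownResnick.IsBrownResnick X₁ P₁ Y₁ Q₁ →
      (∀ i j t s, BrownResnick.crossVariogram Y Q i j t s =
        BrownResnick.crossVariogram Y₁ Q₁ i j t s) →
      BrownResnick.processLaw X P = BrownResnick.processLaw X₁ P₁) ∧
    -- stationarity
    ((∃ g : Fin d → Fin d → BrownResnick.Param p → ℝ,
        ∀ i j t s, BrownResnick.crossVariogram Y Q i j t s = g i j (t - s)) →
      BrownResnick.IsStationary X P) ∧
    -- the finite-dimensional distributions
    (∀ (n : ℕ) (t : Fin n → BrownResnick.Param p) (x : Fin n → Fin d → ℝ),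
      (∀ j i, 0 < x j i) →
      HasPDF (fun ω (j : Fin n) (i : Fin d) => Y (t j) ω i) Q volume →
      0 < P.real {ω | ∀ j i, X (t j) ω i ≤ x j i} ∧
      -Real.log (P.real {ω | ∀ j i, X (t j) ω i ≤ x j i}) =
        ∑ k : Fin d, ∑ l : Fin n, 1 / x l k *
          Q.real {ω | ∀ (i : Fin d) (j : Fin n), (i, j) ≠ (k, l) →
            Y (t j) ω i - Y (t l) ω k -
                variance (fun ω' => Y (t j) ω' i - Y (t l) ω' k) Q / 2
              ≤ Real.log (x j i / x l k)}) := by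
  refine ⟨?_, ?_, ?_⟩
  · intro Ω₁ Ω₁' _ _ P₁ _ Q₁ _ X₁ Y₁ hX₁ hvar
    exact BrownResnick.processLaw_eq_of_forall hX.maxStable.paths hX₁.maxStable.paths
      fun S x hx => BrownResnick.measure_forall_le_eq_of_crossVariogram_eq hX hX₁
        (fun a : S => a.1.1) (fun a => a.1.1) (fun a => a.1.2) hx fun a b => hvar _ _ _ _
  · rintro ⟨g, hg⟩ h
    refine BrownResnick.processLaw_eq_of_forall (hX.maxStable.paths.comp_sub h)
      hX.maxStable.paths fun S x hx => ?_
    -- The process is compared with itself at shifted times, whose differences are unchanged.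
    exact BrownResnick.measure_forall_le_eq_of_crossVariogram_eq hX hX
      (fun a : S => a.1.1 - h) (fun a => a.1.1) (fun a => a.1.2) hx fun a b => by
        rw [hg, hg, sub_sub_sub_cancel_right]
  · intro n t x hx hpdf
    have hset : {ω | ∀ j i, X (t j) ω i ≤ x j i} =
        {ω | ∀ a : Fin d × Fin n, X (t a.2) ω a.1 ≤ x a.2 a.1} := by
      ext ω
      exact ⟨fun h a => h a.2 a.1, fun h j i => h (i, j)⟩
    have hval := hX.measure_forall_le (fun a : Fin d × Fin n => t a.2) (fun a => a.1)
      (x := fun a => x a.2 a.1) (fun a => hx _ _)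
    have hties : ∀ a b : Fin d × Fin n, a ≠ b → ∀ r,
        ∀ᵐ ω ∂Q, Y (t a.2) ω a.1 - Y (t b.2) ω b.1 ≠ r := by
      intro a b hab r
      have h1 := hpdf.absolutelyContinuous (BrownResnick.volume_setOf_sub_eq (i := a.1) (k := b.1)
        (j := a.2) (l := b.2) hab r)
      have h2 := ae_of_ae_map (HasPDF.aemeasurable _ Q volume)
        (measure_eq_zero_iff_ae_notMem.1 h1)
      exact h2
    have hsum := BrownResnick.integral_iSup_exp_eq_sum
      (X := fun (a : Fin d × Fin n) ω => Y (t a.2) ω a.1) (x := fun a => x a.2 a.1)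
      (fun a => hX.measurable_gaussian _ _)
      (BrownResnick.hasGaussianLaw_eval_pi hX.gaussian (fun a : Fin d × Fin n => t a.2)
        fun a => a.1) (fun a => hX.centered _ _) hties (fun a => hx _ _)
    rw [hset, measureReal_def, hval, ENNReal.toReal_ofReal (Real.exp_pos _).le, Real.log_exp,
      neg_neg, hsum, Fintype.sum_prod_type]
    refine ⟨Real.exp_pos _, ?_⟩
    simp only [Prod.forall]
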